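/- Let $n,m,k\ge 1$ (for an SVAR with $n$ variables, $p$ lags and a constant, $m=np+1$). Structural parameters are pairs $(A_0,A_+)\in\mathbb R^{n\times n}\times\mathbb R^{m\times n}$ with $A_0$ invertible; they form the set $\mathbb P^S$. Reduced-form parameters are pairs $(B,\Sigma)\in\mathbb R^{m\times n}\times\mathbb R^{n\times n}$ with $\Sigma$ symmetric positive definite. Let $g(A_0,A_+)=(A_+A_0^{-1},(A_0A_0')^{-1})$. Let $f:U\to\mathbb R^{k\times n}$, $U\subseteq\mathbb P^S$, be admissible, i.e. for every orthogonal $n\times n$ matrix $P$ and every $(A_0,A_+)\in U$ one has $(A_0P,A_+P)\in U$ and $f(A_0P,A_+P)=f(A_0,A_+)P$; and strongly regular, i.e. $U$ is open, $f$ is continuously differentiable with derivative of rank $kn$ at every point of $U$, and $f(U)$ is dense in $\mathbb R^{k\times n}$. Let $Q_1,\dots,Q_n\in\mathbb R^{k\times k}$ with ranks $q_1\ge q_2\ge\dots\ge q_n$. Let $N\subseteq\mathbb P^S$ be a normalization rule: for every $(A_0,A_+)\in\mathbb P^S$ there is a unique diagonal matrix $D$ with diagonal entries $\pm1$ such that $(A_0D,A_+D)\in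 N$. Let $$R=\{(A_0,A_+)\in U\cap N:\ Q_jf(A_0,A_+)e_j=0\text{ for }j=1,\dots,n\}.$$ "Almost every $(B,\Sigma)$" means: all reduced-form parameters in $g(U)$ outside a Lebesgue null set of $\mathbb R^{nm+n(n+1)/2}$, the coordinates being the entries of $B$ and the entries of $\Sigma$ on and below the diagonal. The SVAR is exactly identified if for almost every $(B,\Sigma)$ there is a unique $(A_0,A_+)\in R$ with $g(A_0,A_+)=(B,\Sigma)$. Given $(B,\Sigma)\in g(U)$, let $\Sigma_{tr}$ be the lower-triangular Cholesky factor of $\Sigma$ (positive diagonal, $\Sigma=\Sigma_{tr}\Sigma_{tr}'$), and put $A_0=(\Sigma_{tr}^{-1})'$, $A_+=B(\Sigma_{tr}^{-1})'$. Let $\tilde Q_1=Q_1f(A_0,A_+)$ and, for vectors $p_1,\dots,p_{j-1}\in\mathbb R^n$, let $\tilde Q_j$ be the matrix with the rows of $Q_jf(A_0,A_+)$ followed by $p_1',\dots,p_{j-1}'$. The restrictions are non-redundant at $(B,\Sigma)$ if for every $j=2,\dots,n$ and all unit vectors $p_1,\dots,p_{j-1}$ with $\tilde Q_ip_i=0$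 for $i=1,\dots,j-1$, the matrix $\tilde Q_j$ has full row rank $q_j+(j-1)$ (only $q_j$ rows of $Q_j$ being counted). Theorem. Under these assumptions, the SVAR is exactly identified if and only if $q_j=n-j$ for $j=1,\dots,n$ and the restrictions are non-redundant at almost every $(B,\Sigma)$. -/

import Mathlib

open MeasureTheory
open scoped Matrix

-- The entrywise sup norm on matrices; it induces the usual topology of the space of matrices.
attribute [local instance] Matrix.normedAddCommGroup Matrix.normedSpace

noncomputable section

namespace SVAR

/-- Pairs `(A₀, A₊)` with `A₀` an `n × n` and `A₊` an `m × n` real matrix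
(`m = n * p + 1` for a model with `p` lags and a constant). -/
abbrev StructPair (n m : ℕ) : Type :=
  Matrix (Fin n) (Fin n) ℝ × Matrix (Fin m) (Fin n) ℝ

/-- Pairs `(B, Σ)` with `B` an `m × n` and `Σ` an `n × n` real matrix. -/
abbrev RedPair (n m : ℕ) : Type :=
  Matrix (Fin m) (Fin n) ℝ × Matrix (Fin n) (Fin n) ℝ

/-- The set of structural parameters: `A₀` is invertible. -/
def structParams (n m : ℕ) : Set (StructPair n m) :=
  {A | IsUnit A.1.det}

/-- The set of reduced-form parameters: `Σ` is symmetric positive definite. -/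
def redParams (n m : ℕ) : Set (RedPair n m) :=
  {r | r.2.PosDef}

/-- The map `g (A₀, A₊) = (A₊ A₀⁻¹, (A₀ A₀ᵀ)⁻¹)` from structural to reduced-form parameters. -/
def g {n m : ℕ} (A : StructPair n m) : RedPair n m :=
  (A.2 * A.1⁻¹, (A.1 * A.1ᵀ)⁻¹)

/-- Right multiplication `(A₀ P, A₊ P)`. -/
def rmul {n m : ℕ} (A : StructPair n m) (P : Matrix (Fin n) (Fin n) ℝ) : StructPair n m :=
  (A.1 * P, A.2 * P)

/-- The `n m + n (n + 1) / 2` coordinates of a reduced-form parameter: the entries of `B` and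
the entries of `Σ` on and below the diagonal. -/
def redCoord {n m : ℕ} (r : RedPair n m) :
    (Fin m → Fin n → ℝ) × ({ij : Fin n × Fin n // ij.2 ≤ ij.1} → ℝ) :=
  (fun i j => r.1 i j, fun ij => r.2 ij.1.1 ij.1.2)

/-- `p` holds at almost every reduced-form parameter in `S`: the exceptional points form a
Lebesgue null set in the coordinate space of dimension `n m + n (n + 1) / 2`. -/
def AlmostEvery {n m : ℕ} (S : Set (RedPair n m)) (p : RedPair n m → Prop) : Prop :=
  volume (redCoord '' {r | r ∈ S ∧ r ∈ redParams n m ∧ ¬ p r}) = 0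

/-- Admissibility of `f` on its domain `U`: `U` is stable under right multiplication by
orthogonal matrices, and `f (A₀ P, A₊ P) = f (A₀, A₊) P`. -/
def Admissible {n m k : ℕ} (U : Set (StructPair n m))
    (f : StructPair n m → Matrix (Fin k) (Fin n) ℝ) : Prop :=
  ∀ P ∈ Matrix.orthogonalGroup (Fin n) ℝ, ∀ A ∈ U, rmul A P ∈ U ∧ f (rmul A P) = f A * P

/-- Regularity: `U` is open, and `f` is continuously differentiable on `U` with derivative of
rank `k n` everywhere. -/
def Regular {n m k : ℕ} (U : Set (StructPair n m))
    (f : StructPair n m → Matrix (Fin k) (Fin n) ℝ) : Prop :=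
  IsOpen U ∧ ContDiffOn ℝ 1 f U ∧
    ∀ A ∈ U, Module.finrank ℝ (LinearMap.range (fderiv ℝ f A).toLinearMap) = k * n

/-- Strong regularity: in addition `f (U)` is dense in the set of `k × n` matrices. -/
def StronglyRegular {n m k : ℕ} (U : Set (StructPair n m))
    (f : StructPair n m → Matrix (Fin k) (Fin n) ℝ) : Prop :=
  Regular U f ∧ Dense (f '' U)

/-- Normalization rule: a set `N` of structural parameters such that every structural parameter
is carried into `N` by exactly one diagonal matrix with diagonal entries `±1`. -/
def IsNormalization {n m : ℕ} (N : Set (StructPair n m)) : Prop :=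
  N ⊆ structParams n m ∧
    ∀ A ∈ structParams n m,
      ∃! d : Fin n → ℝ, (∀ i, d i = 1 ∨ d i = -1) ∧ rmul A (Matrix.diagonal d) ∈ N

/-- The restricted structural parameters: the points of `U ∩ N` with `Q_j f(A₀, A₊) e_j = 0`
for all `j`. -/
def restricted {n m k : ℕ} (U N : Set (StructPair n m))
    (f : StructPair n m → Matrix (Fin k) (Fin n) ℝ)
    (Q : Fin n → Matrix (Fin k) (Fin k) ℝ) : Set (StructPair n m) :=
  {A | A ∈ U ∩ N ∧ ∀ j, (Q j * f A) *ᵥ Pi.single j 1 = 0}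

/-- Exact identification: almost every reduced-form parameter (among those attainable from the
domain `U` of `f`) is generated by exactly one restricted structural parameter. -/
def ExactlyIdentified {n m k : ℕ} (U N : Set (StructPair n m))
    (f : StructPair n m → Matrix (Fin k) (Fin n) ℝ)
    (Q : Fin n → Matrix (Fin k) (Fin k) ℝ) : Prop :=
  AlmostEvery (g '' U) fun r => ∃! A : StructPair n m, A ∈ restricted U N f Q ∧ g A = r

/-- `L` is the lower-triangular Cholesky factor (with positive diagonal) of `S`. -/
def IsCholesky {n : ℕ} (L S : Matrix (Fin n) (Fin n) ℝ) : Prop :=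
  (∀ i j, i < j → L i j = 0) ∧ (∀ i, 0 < L i i) ∧ L * Lᵀ = S

/-- The stacked matrix `Q̃_j` with blocks `Q_j X` and `p_1ᵀ, …, p_{j-1}ᵀ`. -/
def Qtilde {n k : ℕ} (Q : Fin n → Matrix (Fin k) (Fin k) ℝ) (X : Matrix (Fin k) (Fin n) ℝ)
    (p : Fin n → Fin n → ℝ) (j : Fin n) : Matrix (Fin k ⊕ {i : Fin n // i < j}) (Fin n) ℝ :=
  Matrix.fromRows (Q j * X) (Matrix.of fun i => p i.1)

/-- Non-redundancy of the restrictions at the reduced-form parameter `(B, Σ)`. With `L` the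
Cholesky factor of `Σ`, put `A₀ = (L⁻¹)ᵀ` and `A₊ = B (L⁻¹)ᵀ`. Whenever unit vectors
`p_1, …, p_{j-1}` have been obtained by successively solving `Q̃_i p_i = 0`, the matrix `Q̃_j`
has full row rank `q_j + (j - 1)` (only the `q_j = rank Q_j` effective rows of `Q_j` count),
for all `j ≥ 2`. As `Fin n` starts at zero, the index `j` here has value `j - 1`. -/
def NonRedundantAt {n m k : ℕ} (f : StructPair n m → Matrix (Fin k) (Fin n) ℝ)
    (Q : Fin n → Matrix (Fin k) (Fin k) ℝ) (r : RedPair n m) : Prop :=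
  ∃ L, IsCholesky L r.2 ∧
    ∀ p : Fin n → Fin n → ℝ, ∀ j : Fin n, 1 ≤ j.val →
      (∀ i < j, p i ⬝ᵥ p i = 1 ∧ Qtilde Q (f ((L⁻¹)ᵀ, r.1 * (L⁻¹)ᵀ)) p i *ᵥ p i = 0) →
      (Qtilde Q (f ((L⁻¹)ᵀ, r.1 * (L⁻¹)ᵀ)) p j).rank = (Q j).rank + j.val

end SVAR

end

/-! Indices below start at 1; the code starts at 0. The structural parameters in `U` over one
reduced form are a single orbit `A * P`, with `P` orthogonal. By admissibility `A * P` satisfies the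
restrictions iff the columns `p_j` of `P` form an orthonormal frame with `Q_j f(A) p_j = 0`, that
is, `Q̃_j p_j = 0` successively; normalization removes the signs. So identification at `g A` means
that a frame for `X = f A` exists and is unique up to signs (`existsUnique_restricted_iff`).

If `q_j ≤ n - j`, frames are built greedily, and uniqueness up to signs forces every `Q̃_j` met on
the way to have a line as kernel; conversely such kernels give uniqueness. When `q_j = n - j` this
is non-redundancy, except at `j = 1`, where non-redundancy says nothing; there `Q_1 X` has rank `n -
1` for almost every `X`.

To force the ranks, exact identification gives frames for a dense set of `X`, hence for all `X` by
compactness of the orthogonal group. A well-chosen degenerate `X` then gives `q_j ≤ n - j`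
(`rank_add_le_of_forall_exists_isFrame`), and uniqueness at one `X` gives equality.

Null sets move between reduced forms, structural parameters and values of `f` because `redCoord ∘ g`
and `f` are submersions. -/

noncomputable section

/-! ### Null sets under submersions -/

section Submersion

open Set Topology

variable {E F : Type*} [NormedAddCommGroup E] [NormedSpace ℝ E] [FiniteDimensional ℝ E]
  [NormedAddCommGroup F] [NormedSpace ℝ F] [FiniteDimensional ℝ F]

/-- Local normal form of a submersion. -/
theorem exists_straightening {φ : E → F} {a : E} (hφ : ContDiffAt ℝ 1 φ a)
    (hr : (fderiv ℝ φ a).range = ⊤) :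
    ∃ e : OpenPartialHomeomorph E (F × (fderiv ℝ φ a).ker), a ∈ e.source ∧
      (∀ x, (e x).1 = φ x) ∧ DifferentiableOn ℝ e e.source ∧
      DifferentiableOn ℝ e.symm e.target := by
  have hs : HasStrictFDerivAt φ (fderiv ℝ φ a) a := hφ.hasStrictFDerivAt one_ne_zero
  have hk := (fderiv ℝ φ a).ker_closedComplemented_of_finiteDimensional_range
  let d := hs.implicitFunctionDataOfComplemented φ (fderiv ℝ φ a) hr hk
  let e := d.toOpenPartialHomeomorph
  have hea : a ∈ e.source := d.pt_mem_toOpenPartialHomeomorph_source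
  have he : ContDiffAt ℝ 1 e a := by
    refine ContDiffAt.prodMk hφ ?_
    change ContDiffAt ℝ 1 (fun x => Classical.choose hk (x - a)) a
    fun_prop
  have hes : ContDiffAt ℝ 1 e.symm (e a) := by
    refine e.contDiffAt_symm (f₀' := d.leftDeriv.equivProdOfSurjectiveOfIsCompl d.rightDeriv
      d.range_leftDeriv d.range_rightDeriv d.isCompl_ker) (e.map_source hea) ?_ ?_
    · rw [e.left_inv hea]
      exact d.hasStrictFDerivAt.hasFDerivAt
    · rw [e.left_inv hea]
      exact he
  obtain ⟨V, hV, hVd⟩ := he.contDiffOn le_rfl (by simp)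
  obtain ⟨W, hW, hWd⟩ := hes.contDiffOn le_rfl (by simp)
  -- The chart is shrunk so that both it and its inverse are differentiable throughout, not just
  -- near `a` and `e a`.
  have hV' : e.source ∩ e ⁻¹' (interior W) ∩ interior V ∈ 𝓝 a := by
    refine Filter.inter_mem (Filter.inter_mem (e.open_source.mem_nhds hea) ?_)
      (interior_mem_nhds.2 hV)
    exact (e.continuousAt hea) (interior_mem_nhds.2 hW)
  have ho : IsOpen (e.source ∩ e ⁻¹' (interior W) ∩ interior V) :=
    (e.isOpen_inter_preimage isOpen_interior).inter isOpen_interior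
  refine ⟨e.restrOpen _ ho, ?_, fun x => rfl, ?_, ?_⟩
  · exact ⟨hea, mem_of_mem_nhds hV'⟩
  · intro x hx
    exact (((hVd.differentiableOn one_ne_zero) x (interior_subset hx.2.2)).differentiableAt
      (mem_interior_iff_mem_nhds.1 hx.2.2)).differentiableWithinAt
  · intro y hy
    have h2 : y ∈ e.target := hy.1
    have h3 : e.symm y ∈ e.source ∩ e ⁻¹' (interior W) ∩ interior V := hy.2
    have h4 : y ∈ interior W := by
      have := h3.1.2
      rwa [mem_preimage, e.right_inv h2] at this
    exact (((hWd.differentiableOn one_ne_zero) y (interior_subset h4)).differentiableAt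
      (mem_interior_iff_mem_nhds.1 h4)).differentiableWithinAt

theorem finrank_prod_ker {L : E →L[ℝ] F} (h : L.range = ⊤) :
    Module.finrank ℝ E = Module.finrank ℝ (F × L.ker) := by
  have := LinearMap.finrank_range_add_finrank_ker (L : E →ₗ[ℝ] F)
  rw [h, finrank_top] at this
  rw [Module.finrank_prod, this]

variable [MeasurableSpace E] [BorelSpace E] [MeasurableSpace F] [BorelSpace F]

/-- A differentiable map between spaces of the same dimension maps null sets to null sets. -/
theorem measure_image_eq_zero_of_differentiableOn {G : Type*} [NormedAddCommGroup G]
    [NormedSpace ℝ G] [FiniteDimensional ℝ G] [MeasurableSpace G] [BorelSpace G]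
    (μ : Measure E) [μ.IsAddHaarMeasure]
    (ν : Measure G) [ν.IsAddHaarMeasure] (h : Module.finrank ℝ E = Module.finrank ℝ G)
    {φ : E → G} {s : Set E} (hφ : DifferentiableOn ℝ φ s) (hs : μ s = 0) : ν (φ '' s) = 0 := by
  -- A linear identification reduces to self-maps of `E`; Haar measures on `G` share their null
  -- sets.
  let L : G ≃L[ℝ] E := ContinuousLinearEquiv.ofFinrankEq h.symm
  have h1 : μ ((fun x => L (φ x)) '' s) = 0 :=
    addHaar_image_eq_zero_of_differentiableOn_of_addHaar_eq_zero μ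
      (L.differentiable.comp_differentiableOn hφ) hs
  have : (μ.map L.symm).IsAddHaarMeasure := L.symm.isAddHaarMeasure_map μ
  refine Measure.absolutelyContinuous_isAddHaarMeasure ν (μ.map L.symm) ?_
  rw [show (L.symm : E → G) = L.symm.toHomeomorph.toMeasurableEquiv from rfl,
    MeasurableEquiv.map_apply]
  convert h1 using 2
  ext y
  constructor
  · rintro ⟨x, hx, hxy⟩
    refine ⟨x, hx, ?_⟩
    change φ x = L.symm y at hxy
    simp [hxy]
  · rintro ⟨x, hx, rfl⟩
    refine ⟨x, hx, ?_⟩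
    change φ x = L.symm (L (φ x))
    simp

/-- The preimage of a null set under a submersion is null. -/
theorem measure_inter_preimage_eq_zero (μ : Measure E) [μ.IsAddHaarMeasure]
    (ν : Measure F) [ν.IsAddHaarMeasure] {φ : E → F} {U : Set E} {T : Set F}
    (hφ : ∀ a ∈ U, ContDiffAt ℝ 1 φ a) (hr : ∀ a ∈ U, (fderiv ℝ φ a).range = ⊤)
    (hT : ν T = 0) : μ (U ∩ φ ⁻¹' T) = 0 := by
  refine measure_null_of_locally_null _ fun a ha => ?_
  obtain ⟨e, hea, hef, -, hed⟩ := exists_straightening (hφ a ha.1) (hr a ha.1)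
  refine ⟨e.source ∩ (U ∩ φ ⁻¹' T), Filter.inter_mem
    (mem_nhdsWithin_of_mem_nhds (e.open_source.mem_nhds hea)) self_mem_nhdsWithin, ?_⟩
  -- In the straightened coordinates the preimage of `T` is a cylinder over `T`.
  have h0 : (ν.prod (Measure.addHaar : Measure (fderiv ℝ φ a).ker)) (e.target ∩ T ×ˢ univ) = 0 :=
    measure_mono_null inter_subset_right (by rw [Measure.prod_prod, hT, zero_mul])
  refine measure_mono_null ?_ (measure_image_eq_zero_of_differentiableOn _ μ
    (finrank_prod_ker (hr a ha.1)).symm (hed.mono inter_subset_left) h0)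
  rintro x ⟨hx, -, hxT⟩
  exact ⟨e x, ⟨e.map_source hx, by rw [hef]; exact hxT, mem_univ _⟩, e.left_inv hx⟩

/-- A set whose preimage under a submersion is null meets the image in a null set. -/
theorem measure_inter_image_eq_zero (μ : Measure E) [μ.IsAddHaarMeasure]
    (ν : Measure F) [ν.IsAddHaarMeasure] {φ : E → F} {U : Set E} (hU : IsOpen U) {T : Set F}
    (hφ : ∀ a ∈ U, ContDiffAt ℝ 1 φ a) (hr : ∀ a ∈ U, (fderiv ℝ φ a).range = ⊤)
    (hT : μ (U ∩ φ ⁻¹' T) = 0) : ν (T ∩ φ '' U) = 0 := by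
  have key : ∀ a ∈ U, ∃ V ∈ 𝓝[U] a, ν (T ∩ φ '' V) = 0 := by
    intro a ha
    obtain ⟨e, hea, hef, hed, -⟩ := exists_straightening (hφ a ha) (hr a ha)
    let κ : Measure (fderiv ℝ φ a).ker := Measure.addHaar
    have h0 : (ν.prod κ) (e '' (U ∩ φ ⁻¹' T ∩ e.source)) = 0 :=
      measure_image_eq_zero_of_differentiableOn μ _ (finrank_prod_ker (hr a ha))
        (hed.mono inter_subset_right) (measure_mono_null inter_subset_left hT)
    have hn : e '' (e.source ∩ U) ∈ 𝓝 ((e a).1, (e a).2) :=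
      (e.isOpen_image_source_inter hU).mem_nhds ⟨a, ⟨hea, ha⟩, rfl⟩
    rw [mem_nhds_prod_iff'] at hn
    obtain ⟨B, C, hB, haB, hC, haC, hBC⟩ := hn
    have h1 : (ν.prod κ) ((T ∩ B) ×ˢ C) = 0 := by
      refine measure_mono_null ?_ h0
      rintro ⟨y, z⟩ ⟨⟨hyT, hyB⟩, hz⟩
      obtain ⟨x, ⟨hxe, hxU⟩, hx⟩ := hBC (show (y, z) ∈ B ×ˢ C from ⟨hyB, hz⟩)
      refine ⟨x, ⟨⟨hxU, ?_⟩, hxe⟩, hx⟩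
      rw [mem_preimage, ← hef, hx]
      exact hyT
    -- `C` is open and nonempty, so the vanishing factor is that of `T ∩ B`. The product formula
    -- needs no measurability of `T`.
    rw [Measure.prod_prod, mul_eq_zero] at h1
    refine ⟨φ ⁻¹' B, mem_nhdsWithin_of_mem_nhds ((hφ a ha).continuousAt (hB.mem_nhds ?_)), ?_⟩
    · rw [← hef]; exact haB
    · refine measure_mono_null ?_ (h1.resolve_right (hC.measure_pos κ ⟨_, haC⟩).ne')
      rintro _ ⟨hT, x, hx, rfl⟩
      exact ⟨hT, hx⟩
  choose! V hV hV0 using key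
  obtain ⟨t, htU, htc, ht⟩ := TopologicalSpace.countable_cover_nhdsWithin hV
  refine measure_mono_null (t := ⋃ a ∈ t, T ∩ φ '' V a) ?_
    ((measure_biUnion_null_iff htc).2 fun a ha => hV0 a (htU ha))
  rintro _ ⟨hT, x, hx, rfl⟩
  obtain ⟨a, ha, hxa⟩ := mem_iUnion₂.1 (ht hx)
  exact mem_iUnion₂.2 ⟨a, ha, hT, x, hxa, rfl⟩

end Submersion

namespace SVAR

/-! ### Linear algebra of frames -/

section Frames

variable {n k : ℕ} (Q : Fin n → Matrix (Fin k) (Fin k) ℝ) (X : Matrix (Fin k) (Fin n) ℝ)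

/-- The vectors `p_i` with `i < s` solve the successive restrictions `Q̃_i p_i = 0`. -/
def IsPartialFrame (p : Fin n → Fin n → ℝ) (s : ℕ) : Prop :=
  ∀ i : Fin n, i.val < s → p i ⬝ᵥ p i = 1 ∧ Qtilde Q X p i *ᵥ p i = 0

/-- An orthonormal frame that solves all restrictions. -/
def IsFrame (p : Fin n → Fin n → ℝ) : Prop :=
  ∀ i : Fin n, p i ⬝ᵥ p i = 1 ∧ Qtilde Q X p i *ᵥ p i = 0

/-- Any two frames that solve the restrictions agree up to signs. -/
def FrameUnique : Prop :=
  ∀ p p' : Fin n → Fin n → ℝ, IsFrame Q X p → IsFrame Q X p' → ∀ j, p' j = p j ∨ p' j = -p j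

variable {Q X}

theorem qtilde_mulVec_eq_zero_iff {p : Fin n → Fin n → ℝ} {j : Fin n} {v : Fin n → ℝ} :
    Qtilde Q X p j *ᵥ v = 0 ↔ (Q j * X) *ᵥ v = 0 ∧ ∀ i < j, p i ⬝ᵥ v = 0 := by
  rw [Qtilde, Matrix.fromRows_mulVec, funext_iff, Sum.forall, funext_iff]
  simp only [Sum.elim_inl, Sum.elim_inr, Subtype.forall]
  rfl

theorem qtilde_congr {p p' : Fin n → Fin n → ℝ} {j : Fin n} (h : ∀ i < j, p' i = p i) :
    Qtilde Q X p' j = Qtilde Q X p j := by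
  unfold Qtilde
  congr 2
  ext i l
  rw [h i.1 i.2]

theorem isFrame_iff {p : Fin n → Fin n → ℝ} :
    IsFrame Q X p ↔ (∀ i, (Q i * X) *ᵥ p i = 0) ∧
      Matrix.of p * (Matrix.of p)ᵀ = 1 := by
  have hM : Matrix.of p * (Matrix.of p)ᵀ = 1 ↔
      ∀ i j, p i ⬝ᵥ p j = if i = j then 1 else 0 := by
    rw [← Matrix.ext_iff]
    simp only [Matrix.mul_apply, Matrix.one_apply, dotProduct, Matrix.transpose_apply,
      Matrix.of_apply]
  rw [hM]
  simp only [IsFrame, qtilde_mulVec_eq_zero_iff]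
  constructor
  · intro h
    refine ⟨fun i => (h i).2.1, fun i j => ?_⟩
    rcases lt_trichotomy i j with hij | rfl | hij
    · rw [if_neg hij.ne, (h j).2.2 i hij]
    · rw [if_pos rfl, (h i).1]
    · rw [if_neg hij.ne', dotProduct_comm, (h i).2.2 j hij]
  · rintro ⟨h1, h2⟩ i
    refine ⟨by rw [h2, if_pos rfl], h1 i, fun j hj => by rw [h2, if_neg hj.ne]⟩

theorem rank_add_le {ι : Type*} [Finite ι] (M M' : Matrix ι (Fin n) ℝ) :
    (M + M').rank ≤ M.rank + M'.rank := by
  refine le_trans (Submodule.finrank_mono ?_) (Submodule.finrank_add_le_finrank_add_finrank _ _)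
  rintro _ ⟨v, rfl⟩
  rw [Matrix.mulVecLin_add]
  exact Submodule.add_mem_sup ⟨v, rfl⟩ ⟨v, rfl⟩

/-- The two row blocks contribute at most `rank Q_j` and the number of earlier vectors.
Non-redundancy asks for equality here. -/
theorem rank_qtilde_le (p : Fin n → Fin n → ℝ) (j : Fin n) :
    (Qtilde Q X p j).rank ≤ (Q j).rank + j.val := by
  have h : Qtilde Q X p j =
      Matrix.fromRows (1 : Matrix (Fin k) (Fin k) ℝ) 0 * (Q j * X) +
      Matrix.fromRows (0 : Matrix (Fin k) {i : Fin n // i < j} ℝ) 1 *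
        Matrix.of fun i : {i : Fin n // i < j} => p i.1 := by
    rw [Qtilde, Matrix.fromRows_mul, Matrix.fromRows_mul]
    ext (i | i) l <;> simp
  rw [h]
  refine (rank_add_le _ _).trans (add_le_add ?_ ?_)
  · exact (Matrix.rank_mul_le_right _ _).trans (Matrix.rank_mul_le_left _ _)
  · refine (Matrix.rank_mul_le_right _ _).trans ((Matrix.rank_le_card_height _).trans ?_)
    rw [Fintype.card_subtype, Finset.filter_gt_eq_Iio, Fin.card_Iio]

theorem rank_add_finrank_ker {ι : Type*} (M : Matrix ι (Fin n) ℝ) :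
    M.rank + Module.finrank ℝ (LinearMap.ker M.mulVecLin) = n := by
  have := LinearMap.finrank_range_add_finrank_ker M.mulVecLin
  rwa [Module.finrank_fin_fun] at this

theorem exists_smul_dotProduct_self_eq_one {v : Fin n → ℝ} (hv : v ≠ 0) :
    ∃ c : ℝ, c ≠ 0 ∧ (c • v) ⬝ᵥ (c • v) = 1 := by
  have h : 0 < v ⬝ᵥ v := lt_of_le_of_ne
    (Finset.sum_nonneg fun i _ => mul_self_nonneg _) (fun h => hv (dotProduct_self_eq_zero.1 h.symm))
  have hs := Real.sqrt_pos.2 h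
  refine ⟨(√(v ⬝ᵥ v))⁻¹, by positivity, ?_⟩
  rw [smul_dotProduct, dotProduct_smul, smul_eq_mul, smul_eq_mul, ← mul_assoc, ← mul_inv,
    Real.mul_self_sqrt h.le, inv_mul_cancel₀ h.ne']

theorem exists_dotProduct_self_eq_one {W : Submodule ℝ (Fin n → ℝ)}
    (hW : 1 ≤ Module.finrank ℝ W) : ∃ v ∈ W, v ⬝ᵥ v = 1 := by
  have : Nontrivial W := Module.nontrivial_of_finrank_pos hW
  obtain ⟨v, hv⟩ := exists_ne (0 : W)
  obtain ⟨c, -, hc⟩ := exists_smul_dotProduct_self_eq_one (v := v.1) (by simpa using hv)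
  exact ⟨c • v.1, W.smul_mem c v.2, hc⟩

/-- Normalize a vector off the line spanned by a first unit vector. This yields two frame choices
that no sign relates. -/
theorem exists_pair_dotProduct_self_eq_one {W : Submodule ℝ (Fin n → ℝ)}
    (hW : 2 ≤ Module.finrank ℝ W) :
    ∃ v ∈ W, ∃ w ∈ W, v ⬝ᵥ v = 1 ∧ w ⬝ᵥ w = 1 ∧ w ≠ v ∧ w ≠ -v := by
  obtain ⟨v, hv, hv1⟩ := exists_dotProduct_self_eq_one (one_le_two.trans hW)
  have : ∃ u ∈ W, u ∉ Submodule.span ℝ {v} := by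
    by_contra! h
    have h1 := Submodule.finrank_mono (show W ≤ Submodule.span ℝ {v} from h)
    have h2 := finrank_span_le_card (R := ℝ) ({v} : Set (Fin n → ℝ))
    rw [Set.toFinset_singleton, Finset.card_singleton] at h2
    omega
  obtain ⟨u, hu, huv⟩ := this
  obtain ⟨c, hc0, hc⟩ := exists_smul_dotProduct_self_eq_one (v := u)
    (by rintro rfl; exact huv (zero_mem _))
  have key : ∀ x ∈ Submodule.span ℝ {v}, c • u ≠ x := by
    rintro x hx rfl
    exact huv ((Submodule.smul_mem_iff _ hc0).1 hx)
  exact ⟨v, hv, c • u, W.smul_mem c hu, hv1, hc, key _ (Submodule.mem_span_singleton_self v),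
    key _ (neg_mem (Submodule.mem_span_singleton_self v))⟩

theorem IsPartialFrame.update {p : Fin n → Fin n → ℝ} {j : Fin n} (hp : IsPartialFrame Q X p j)
    {v : Fin n → ℝ} (hv : v ⬝ᵥ v = 1) (hvj : Qtilde Q X p j *ᵥ v = 0) :
    IsPartialFrame Q X (Function.update p j v) (j + 1) := by
  intro i hi
  rcases (Nat.lt_succ_iff.1 hi).lt_or_eq with h | h
  · have hij : i < j := h
    rw [qtilde_congr (p := p) fun l hl => Function.update_of_ne (hl.trans hij).ne _ _,
      Function.update_of_ne hij.ne]
    exact hp i h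
  · obtain rfl : i = j := Fin.ext h
    rw [qtilde_congr (p := p) fun l hl => Function.update_of_ne hl.ne _ _, Function.update_self]
    exact ⟨hv, hvj⟩

/-- Partial solutions can be completed when there are few restrictions. -/
theorem IsPartialFrame.exists_isFrame (hq : ∀ j : Fin n, (Q j).rank + (j.val + 1) ≤ n)
    {p : Fin n → Fin n → ℝ} {s : ℕ} (hp : IsPartialFrame Q X p s) :
    ∃ p', IsFrame Q X p' ∧ ∀ i : Fin n, i.val < s → p' i = p i := by
  have key : ∀ t, s ≤ t → ∃ p', IsPartialFrame Q X p' t ∧ ∀ i : Fin n, i.val < s → p' i = p i := by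
    intro t ht
    induction t, ht using Nat.le_induction with
    | base => exact ⟨p, hp, fun _ _ => rfl⟩
    | succ t ht ih =>
      obtain ⟨p', hp', hpp⟩ := ih
      by_cases htn : t < n
      · let j : Fin n := ⟨t, htn⟩
        have h1 := rank_qtilde_le (Q := Q) (X := X) p' j
        have h2 := rank_add_finrank_ker (Qtilde Q X p' j)
        have h3 := hq j
        -- The kernel has dimension at least `n - (rank Q_j + j) ≥ 1`.
        obtain ⟨v, hv, hv1⟩ := exists_dotProduct_self_eq_one
          (W := LinearMap.ker (Qtilde Q X p' j).mulVecLin) (by omega)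
        refine ⟨_, hp'.update (j := j) hv1 hv, fun i hi => ?_⟩
        rw [Function.update_of_ne, hpp i hi]
        exact fun h => (hi.trans_le ht).ne (congrArg Fin.val h)
      · exact ⟨p', fun i _ => hp' i (i.2.trans_le (not_lt.1 htn)), hpp⟩
  obtain ⟨p', hp', hpp⟩ := key (max s n) (le_max_left _ _)
  exact ⟨p', fun i => hp' i (i.2.trans_le (le_max_right _ _)), hpp⟩

theorem exists_isFrame (hq : ∀ j : Fin n, (Q j).rank + (j.val + 1) ≤ n) :
    ∃ p, IsFrame Q X p := by
  obtain ⟨p, hp, -⟩ := IsPartialFrame.exists_isFrame (X := X) hq (p := 0) (s := 0)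
    (fun i hi => absurd hi (Nat.not_lt_zero _))
  exact ⟨p, hp⟩

/-- If the frame is unique up to signs, then each `Q̃_j` has a one-dimensional kernel. -/
theorem IsPartialFrame.rank_qtilde_add_one (hq : ∀ j : Fin n, (Q j).rank + (j.val + 1) ≤ n)
    (hu : FrameUnique Q X) {p : Fin n → Fin n → ℝ} {j : Fin n} (hp : IsPartialFrame Q X p j) :
    (Qtilde Q X p j).rank + 1 = n := by
  have h1 := rank_qtilde_le (Q := Q) (X := X) p j
  have h2 := rank_add_finrank_ker (Qtilde Q X p j)
  have h3 := hq j
  by_contra hne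
  -- A kernel of dimension two would allow two essentially different `j`-th vectors, and both
  -- choices extend to full frames.
  obtain ⟨v, hv, w, hw, hv1, hw1, hwv, hwv'⟩ := exists_pair_dotProduct_self_eq_one
    (W := LinearMap.ker (Qtilde Q X p j).mulVecLin) (by omega)
  obtain ⟨a, ha, haj⟩ := (hp.update hv1 hv).exists_isFrame hq
  obtain ⟨b, hb, hbj⟩ := (hp.update hw1 hw).exists_isFrame hq
  have ha' := haj j (Nat.lt_succ_self _)
  have hb' := hbj j (Nat.lt_succ_self _)
  rw [Function.update_self] at ha' hb'
  have := hu a b ha hb j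
  rw [ha', hb'] at this
  exact this.elim hwv hwv'

/-- Uniqueness gives `Q̃_j` rank `n - 1`, while its rank is at most `rank Q_j + j`. -/
theorem rank_eq_of_frameUnique (hq : ∀ j : Fin n, (Q j).rank + (j.val + 1) ≤ n)
    (hu : FrameUnique Q X) (j : Fin n) : (Q j).rank = n - (j.val + 1) := by
  obtain ⟨p, hp⟩ := exists_isFrame (X := X) hq
  have h1 := rank_qtilde_le (Q := Q) (X := X) p j
  have h2 := IsPartialFrame.rank_qtilde_add_one (j := j) hq hu fun i _ => hp i
  have h3 := hq j
  omega

theorem eq_or_eq_neg_of_finrank_le_one {W : Submodule ℝ (Fin n → ℝ)}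
    (hW : Module.finrank ℝ W ≤ 1) {v w : Fin n → ℝ} (hv : v ∈ W) (hw : w ∈ W)
    (hv1 : v ⬝ᵥ v = 1) (hw1 : w ⬝ᵥ w = 1) : w = v ∨ w = -v := by
  have hv0 : (⟨v, hv⟩ : W) ≠ 0 := by
    intro h
    have : v = 0 := congrArg Subtype.val h
    simp [this] at hv1
  have : Nontrivial W := ⟨_, _, hv0⟩
  obtain ⟨c, hc⟩ := (finrank_eq_one_iff_of_nonzero' (⟨v, hv⟩ : W) hv0).1
    (le_antisymm hW Module.finrank_pos) ⟨w, hw⟩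
  have hc' : w = c • v := (congrArg Subtype.val hc).symm
  rw [hc', smul_dotProduct, dotProduct_smul, hv1, smul_eq_mul, smul_eq_mul, mul_one,
    mul_self_eq_one_iff] at hw1
  rcases hw1 with rfl | rfl <;> simp [hc']

/-- If each `Q̃_j` has a kernel of dimension at most one, then the frame is unique up to signs. -/
theorem frameUnique_of_le_rank
    (h : ∀ p, ∀ j : Fin n, IsFrame Q X p → n ≤ (Qtilde Q X p j).rank + 1) :
    FrameUnique Q X := by
  intro p p' hp hp' j
  induction j using WellFoundedLT.induction with
  | _ j ih =>
    have h1 := h p j hp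
    have h2 := rank_add_finrank_ker (Qtilde Q X p j)
    refine eq_or_eq_neg_of_finrank_le_one
      (W := LinearMap.ker (Qtilde Q X p j).mulVecLin) (by omega) (hp j).2 ?_ (hp j).1 (hp' j).1
    change Qtilde Q X p j *ᵥ p' j = 0
    have h3 := qtilde_mulVec_eq_zero_iff.1 (hp' j).2
    refine qtilde_mulVec_eq_zero_iff.2 ⟨h3.1, fun i hi => ?_⟩
    have h4 := h3.2 i hi
    -- Earlier vectors differ only by signs, which do not affect orthogonality, so `p' j` lies in
    -- the kernel of the `Q̃_j` built from `p`.
    rcases ih i hi with h5 | h5 <;> rw [h5] at h4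
    · exact h4
    · rwa [neg_dotProduct, neg_eq_zero] at h4

end Frames

/-! ### Orthogonal orbits and frames -/

section Orbits

variable {n m k : ℕ}

theorem g_rmul (A : StructPair n m) {P : Matrix (Fin n) (Fin n) ℝ}
    (hP : P ∈ Matrix.orthogonalGroup (Fin n) ℝ) : g (rmul A P) = g A := by
  have h1 : P * Pᵀ = 1 := (Matrix.mem_orthogonalGroup_iff _ _).1 hP
  have h2 : P * P⁻¹ = 1 := Matrix.mul_nonsing_inv _ (Matrix.isUnit_det_of_right_inverse h1)
  refine Prod.ext ?_ ?_
  · change A.2 * P * (A.1 * P)⁻¹ = A.2 * A.1⁻¹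
    rw [Matrix.mul_inv_rev, Matrix.mul_assoc, ← Matrix.mul_assoc P, h2, Matrix.one_mul]
  · change (A.1 * P * (A.1 * P)ᵀ)⁻¹ = (A.1 * A.1ᵀ)⁻¹
    rw [Matrix.transpose_mul, Matrix.mul_assoc, ← Matrix.mul_assoc P, h1, Matrix.one_mul]

theorem exists_rmul_eq_of_g_eq {A A' : StructPair n m} (hA : A ∈ structParams n m)
    (hA' : A' ∈ structParams n m) (h : g A' = g A) :
    ∃ P ∈ Matrix.orthogonalGroup (Fin n) ℝ, A' = rmul A P := by
  have hA : IsUnit A.1.det := hA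
  have hA' : IsUnit A'.1.det := hA'
  have h1 : A'.2 * A'.1⁻¹ = A.2 * A.1⁻¹ := congrArg Prod.fst h
  have h2 : (A'.1 * A'.1ᵀ)⁻¹ = (A.1 * A.1ᵀ)⁻¹ := congrArg Prod.snd h
  have h3 : A'.1 * A'.1ᵀ = A.1 * A.1ᵀ := by
    have h4 := congrArg (fun M => M⁻¹) h2
    rwa [Matrix.nonsing_inv_nonsing_inv _ (by simpa [Matrix.det_mul] using hA'),
      Matrix.nonsing_inv_nonsing_inv _ (by simpa [Matrix.det_mul] using hA)] at h4
  refine ⟨A.1⁻¹ * A'.1, (Matrix.mem_orthogonalGroup_iff _ _).2 ?_, Prod.ext ?_ ?_⟩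
  · change A.1⁻¹ * A'.1 * (A.1⁻¹ * A'.1)ᵀ = 1
    rw [Matrix.transpose_mul, Matrix.mul_assoc, ← Matrix.mul_assoc A'.1, h3, Matrix.mul_assoc A.1,
      ← Matrix.mul_assoc, Matrix.nonsing_inv_mul _ hA, Matrix.one_mul, ← Matrix.transpose_mul,
      Matrix.nonsing_inv_mul _ hA, Matrix.transpose_one]
  · change A'.1 = A.1 * (A.1⁻¹ * A'.1)
    rw [Matrix.mul_nonsing_inv_cancel_left _ _ hA]
  · change A'.2 = A.2 * (A.1⁻¹ * A'.1)
    rw [← Matrix.mul_assoc, ← h1, Matrix.nonsing_inv_mul_cancel_right _ _ hA']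

theorem rmul_rmul (A : StructPair n m) (P R : Matrix (Fin n) (Fin n) ℝ) :
    rmul (rmul A P) R = rmul A (P * R) :=
  Prod.ext (Matrix.mul_assoc _ _ _) (Matrix.mul_assoc _ _ _)

theorem rmul_left_injective {A : StructPair n m} (hA : A ∈ structParams n m)
    {P R : Matrix (Fin n) (Fin n) ℝ} (h : rmul A P = rmul A R) : P = R := by
  have hA : IsUnit A.1.det := hA
  have h1 : A.1 * P = A.1 * R := congrArg Prod.fst h
  rw [← Matrix.nonsing_inv_mul_cancel_left _ P hA, h1, Matrix.nonsing_inv_mul_cancel_left _ _ hA]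

theorem diagonal_mem_orthogonalGroup {d : Fin n → ℝ} (hd : ∀ i, d i = 1 ∨ d i = -1) :
    Matrix.diagonal d ∈ Matrix.orthogonalGroup (Fin n) ℝ := by
  refine (Matrix.mem_orthogonalGroup_iff _ _).2 ?_
  change Matrix.diagonal d * (Matrix.diagonal d)ᵀ = 1
  rw [Matrix.diagonal_transpose, Matrix.diagonal_mul_diagonal, ← Matrix.diagonal_one]
  congr 1
  ext i
  rcases hd i with h | h <;> simp [h]

variable {U N : Set (StructPair n m)} {f : StructPair n m → Matrix (Fin k) (Fin n) ℝ}
  {Q : Fin n → Matrix (Fin k) (Fin k) ℝ}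

/-- By admissibility `f (A P) e_j` is `f A` applied to the `j`-th column of `P`. -/
theorem rmul_mem_restricted_iff (hadm : Admissible U f) {A : StructPair n m} (hA : A ∈ U)
    {P : Matrix (Fin n) (Fin n) ℝ} (hP : P ∈ Matrix.orthogonalGroup (Fin n) ℝ) :
    rmul A P ∈ restricted U N f Q ↔ rmul A P ∈ N ∧ IsFrame Q (f A) fun j i => P i j := by
  have h1 : Pᵀ * Pᵀᵀ = 1 := (Matrix.mem_orthogonalGroup_iff' _ _).1 hP
  obtain ⟨hU, hf⟩ := hadm P hP A hA
  have h2 : ∀ j, (Q j * f (rmul A P)) *ᵥ Pi.single j 1 = (Q j * f A) *ᵥ fun i => P i j := by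
    intro j
    rw [hf, ← Matrix.mul_assoc, ← Matrix.mulVec_mulVec, Matrix.mulVec_single_one]
    rfl
  rw [isFrame_iff]
  constructor
  · rintro ⟨⟨-, hN⟩, h⟩
    exact ⟨hN, fun i => by rw [← h2, h], h1⟩
  · rintro ⟨hN, h, -⟩
    exact ⟨⟨hU, hN⟩, fun i => by rw [h2, h]⟩

theorem isFrame_of_signs {X : Matrix (Fin k) (Fin n) ℝ} {p : Fin n → Fin n → ℝ}
    (hp : IsFrame Q X p) {d : Fin n → ℝ} (hd : ∀ i, d i = 1 ∨ d i = -1) :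
    IsFrame Q X fun i => d i • p i := by
  intro i
  have hdd : d i * d i = 1 := by rcases hd i with h | h <;> simp [h]
  have h := qtilde_mulVec_eq_zero_iff.1 (hp i).2
  refine ⟨?_, qtilde_mulVec_eq_zero_iff.2 ⟨?_, fun j hj => ?_⟩⟩
  · rw [smul_dotProduct, dotProduct_smul, (hp i).1, smul_eq_mul, smul_eq_mul, mul_one, hdd]
  · rw [Matrix.mulVec_smul, h.1, smul_zero]
  · rw [smul_dotProduct, dotProduct_smul, h.2 j hj, smul_zero, smul_zero]

theorem IsFrame.transpose_mem_orthogonalGroup {X : Matrix (Fin k) (Fin n) ℝ}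
    {p : Fin n → Fin n → ℝ} (hp : IsFrame Q X p) :
    (Matrix.of p)ᵀ ∈ Matrix.orthogonalGroup (Fin n) ℝ :=
  (Matrix.mem_orthogonalGroup_iff' _ _).2 (isFrame_iff.1 hp).2

theorem transpose_mul_diagonal (p : Fin n → Fin n → ℝ) (d : Fin n → ℝ) :
    (fun j i => ((Matrix.of p)ᵀ * Matrix.diagonal d) i j) = fun j => d j • p j := by
  ext j i
  simp [Matrix.transpose_apply, Matrix.mul_diagonal, mul_comm]

/-- The structural parameters over a reduced form that satisfy the restrictions correspond to
the frames that solve the restrictions, up to signs. -/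
theorem existsUnique_restricted_iff (hU : U ⊆ structParams n m) (hN : IsNormalization N)
    (hadm : Admissible U f) {A : StructPair n m} (hA : A ∈ U) :
    (∃! A', A' ∈ restricted U N f Q ∧ g A' = g A) ↔
      (∃ p, IsFrame Q (f A) p) ∧ FrameUnique Q (f A) := by
  have toR : ∀ p, IsFrame Q (f A) p → ∃ d : Fin n → ℝ, (∀ i, d i = 1 ∨ d i = -1) ∧
      rmul A ((Matrix.of p)ᵀ * Matrix.diagonal d) ∈ restricted U N f Q ∧
      g (rmul A ((Matrix.of p)ᵀ * Matrix.diagonal d)) = g A := by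
    intro p hp
    have hP := hp.transpose_mem_orthogonalGroup
    obtain ⟨d, ⟨hd, hdN⟩, -⟩ := hN.2 (rmul A (Matrix.of p)ᵀ) (hU (hadm _ hP A hA).1)
    have hPD := mul_mem hP (diagonal_mem_orthogonalGroup hd)
    refine ⟨d, hd, ?_, g_rmul A hPD⟩
    rw [rmul_mem_restricted_iff hadm hA hPD, transpose_mul_diagonal, ← rmul_rmul]
    exact ⟨hdN, isFrame_of_signs hp hd⟩
  have ofR : ∀ A', A' ∈ restricted U N f Q → g A' = g A →
      ∃ P, A' = rmul A P ∧ rmul A P ∈ N ∧ IsFrame Q (f A) fun j i => P i j := by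
    intro A' hA' hg
    obtain ⟨P, hP, rfl⟩ := exists_rmul_eq_of_g_eq (hU hA) (hU hA'.1.1) hg
    exact ⟨P, rfl, (rmul_mem_restricted_iff hadm hA hP).1 hA'⟩
  constructor
  · rintro ⟨A', ⟨hA', hg⟩, huniq⟩
    obtain ⟨P, -, -, hPf⟩ := ofR A' hA' hg
    refine ⟨⟨_, hPf⟩, fun p p' hp hp' j => ?_⟩
    obtain ⟨d, hd, h1, h2⟩ := toR p hp
    obtain ⟨d', hd', h1', h2'⟩ := toR p' hp'
    have h3 := rmul_left_injective (hU hA)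
      ((huniq _ ⟨h1, h2⟩).trans (huniq _ ⟨h1', h2'⟩).symm)
    have h4 : d j • p j = d' j • p' j := by
      have h5 := congrFun (transpose_mul_diagonal p d) j
      rw [h3] at h5
      exact h5.symm.trans (congrFun (transpose_mul_diagonal p' d') j)
    rcases hd j with h5 | h5 <;> rcases hd' j with h6 | h6 <;> rw [h5, h6] at h4
    · left; simpa using h4.symm
    · right; rw [one_smul, neg_one_smul] at h4; rw [h4, neg_neg]
    · right; rw [one_smul, neg_one_smul] at h4; exact h4.symm
    · left; simpa using h4.symm
  · rintro ⟨⟨p, hp⟩, huniq⟩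
    obtain ⟨d, hd, h1, h2⟩ := toR p hp
    refine ⟨_, ⟨h1, h2⟩, ?_⟩
    rintro A₁ ⟨hA₁, hg₁⟩
    obtain ⟨P, -, hPN, hP⟩ := ofR _ h1 h2
    obtain ⟨R, rfl, hRN, hR⟩ := ofR _ hA₁ hg₁
    obtain ⟨P, hPe, hPN, hP⟩ := ofR _ h1 h2
    rw [hPe]
    have h3 := huniq _ _ hP hR
    have h4 : ∀ j, ∃ c : ℝ, (c = 1 ∨ c = -1) ∧ (fun i => R i j) = c • fun i => P i j := by
      intro j
      rcases h3 j with h | h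
      · exact ⟨1, Or.inl rfl, by rw [h, one_smul]⟩
      · exact ⟨-1, Or.inr rfl, by rw [h, neg_one_smul]⟩
    choose c hc hRP using h4
    have h5 : R = P * Matrix.diagonal c := by
      ext i j
      have := congrFun (hRP j) i
      simpa [Matrix.mul_diagonal, mul_comm] using this
    have h6 : rmul A P ∈ structParams n m := hN.1 hPN
    -- The sign patterns `c` and `1` both carry `rmul A P` into `N`, so they coincide.
    have h7 : c = 1 := (hN.2 _ h6).unique ⟨hc, by rwa [rmul_rmul, ← h5]⟩
      ⟨fun i => Or.inl rfl, by
        rw [rmul_rmul, show Matrix.diagonal (1 : Fin n → ℝ) = 1 from Matrix.diagonal_one,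
          Matrix.mul_one]
        exact hPN⟩
    rw [h5, h7, show Matrix.diagonal (1 : Fin n → ℝ) = 1 from Matrix.diagonal_one, Matrix.mul_one]

/-! ### Cholesky factors and non-redundancy -/

/-- Existence of the Cholesky factorization of `Mᵀ M`. -/
theorem exists_isCholesky {M : Matrix (Fin n) (Fin n) ℝ} (hM : IsUnit M.det) :
    ∃ L, IsCholesky L (Mᵀ * M) := by
  -- Triangularity is itself a system of restrictions: a frame for `D` and `Mᵀ`, taken in reverse
  -- order as columns of `O`, makes `Mᵀ * O` lower triangular.
  let D : Fin n → Matrix (Fin n) (Fin n) ℝ := fun j =>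
    Matrix.diagonal fun i => if i < j.rev then 1 else 0
  have hD : ∀ j : Fin n, (D j).rank + (j.val + 1) ≤ n := by
    intro j
    have : (D j).rank = j.rev := by
      rw [Matrix.rank_diagonal, Fintype.card_subtype]
      simp [Finset.filter_gt_eq_Iio]
    rw [this, Fin.val_rev]
    omega
  obtain ⟨p, hp⟩ := exists_isFrame (X := Mᵀ) hD
  obtain ⟨hp1, hp2⟩ := isFrame_iff.1 hp
  let O : Matrix (Fin n) (Fin n) ℝ := Matrix.of fun a c => p c.rev a
  have hO : O * Oᵀ = 1 := by
    rw [mul_eq_one_comm]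
    ext a c
    have := congrFun (congrFun hp2 a.rev) c.rev
    simp only [Matrix.mul_apply, Matrix.transpose_apply, Matrix.of_apply, O, Matrix.one_apply,
      Fin.rev_inj] at this ⊢
    exact this
  let L₀ := Mᵀ * O
  have hL₀ : L₀ * L₀ᵀ = Mᵀ * M := by
    rw [Matrix.transpose_mul, Matrix.mul_assoc, ← Matrix.mul_assoc O, hO, Matrix.one_mul,
      Matrix.transpose_transpose]
  have hlow : ∀ i j, i < j → L₀ i j = 0 := by
    intro i j hij
    have h1 := congrFun (hp1 j.rev) i
    rw [← Matrix.mulVec_mulVec, Matrix.mulVec_diagonal, Fin.rev_rev, if_pos hij, one_mul] at h1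
    exact h1
  have hdiag : ∀ i, L₀ i i ≠ 0 := by
    have h1 : L₀.det = ∏ i, L₀ i i := Matrix.det_of_isLowerTriangular L₀ fun i j hij => hlow i j hij
    have h2 : L₀.det ≠ 0 := by
      intro h
      have h3 := congrArg Matrix.det hL₀
      rw [Matrix.det_mul, h, zero_mul, Matrix.det_mul, Matrix.det_transpose] at h3
      exact (mul_ne_zero hM.ne_zero hM.ne_zero) h3.symm
    rw [h1, Finset.prod_ne_zero_iff] at h2
    exact fun i => h2 i (Finset.mem_univ i)
  let s : Fin n → ℝ := fun i => if 0 < L₀ i i then 1 else -1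
  have hs : ∀ i, s i = 1 ∨ s i = -1 := fun i => by
    simp only [s]; split_ifs <;> simp
  refine ⟨L₀ * Matrix.diagonal s, fun i j hij => ?_, fun i => ?_, ?_⟩
  · rw [Matrix.mul_diagonal, hlow i j hij, zero_mul]
  · rw [Matrix.mul_diagonal]
    simp only [s]
    split_ifs with h
    · simpa using h
    · have := lt_of_le_of_ne (not_lt.1 h) (hdiag i)
      linarith
  · have h1 : Matrix.diagonal s * (Matrix.diagonal s)ᵀ = 1 :=
      (Matrix.mem_orthogonalGroup_iff _ _).1 (diagonal_mem_orthogonalGroup hs)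
    rw [Matrix.transpose_mul, Matrix.mul_assoc, ← Matrix.mul_assoc (Matrix.diagonal s), h1,
      Matrix.one_mul, hL₀]

theorem exists_isCholesky_g {A : StructPair n m} (hA : A ∈ structParams n m) :
    ∃ L, IsCholesky L (g A).2 := by
  have h : (g A).2 = (A.1⁻¹)ᵀ * A.1⁻¹ := by
    rw [Matrix.transpose_nonsing_inv, ← Matrix.mul_inv_rev]
    rfl
  rw [h]
  exact exists_isCholesky (Matrix.isUnit_nonsing_inv_det _ hA)

theorem posDef_g {A : StructPair n m} (hA : A ∈ structParams n m) : g A ∈ redParams n m := by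
  have hA : IsUnit A.1.det := hA
  change ((A.1 * A.1ᵀ)⁻¹).PosDef
  have h := Matrix.PosDef.one (n := Fin n) (R := ℝ)
  have := Matrix.PosDef.mul_mul_conjTranspose_same h (B := A.1)
    (Matrix.vecMul_injective_of_isUnit ((Matrix.isUnit_iff_isUnit_det _).2 hA))
  rw [Matrix.mul_one] at this
  exact this.inv

/-- The structural parameter obtained from the Cholesky factor of `Σ`. -/
theorem cholesky_mem (hU : U ⊆ structParams n m) (hadm : Admissible U f) {A : StructPair n m}
    (hA : A ∈ U) {L : Matrix (Fin n) (Fin n) ℝ} (hL : IsCholesky L (g A).2) :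
    (((L⁻¹)ᵀ, (g A).1 * (L⁻¹)ᵀ) : StructPair n m) ∈ U ∧
      g (((L⁻¹)ᵀ, (g A).1 * (L⁻¹)ᵀ) : StructPair n m) = g A := by
  have hA1 : IsUnit A.1.det := hU hA
  have hLd : IsUnit L.det := by
    have h1 : IsUnit ((A.1 * A.1ᵀ)⁻¹).det :=
      Matrix.isUnit_nonsing_inv_det _ (by simpa [Matrix.det_mul] using hA1)
    rw [show (A.1 * A.1ᵀ)⁻¹ = L * Lᵀ from hL.2.2.symm, Matrix.det_mul] at h1
    exact isUnit_of_mul_isUnit_left h1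
  have hLi : IsUnit (L⁻¹)ᵀ.det := by
    rw [Matrix.det_transpose]
    exact Matrix.isUnit_nonsing_inv_det _ hLd
  have hg : g (((L⁻¹)ᵀ, (g A).1 * (L⁻¹)ᵀ) : StructPair n m) = g A := by
    refine Prod.ext ?_ ?_
    · change (g A).1 * (L⁻¹)ᵀ * ((L⁻¹)ᵀ)⁻¹ = (g A).1
      rw [Matrix.mul_nonsing_inv_cancel_right _ _ hLi]
    · change ((L⁻¹)ᵀ * (L⁻¹)ᵀᵀ)⁻¹ = (g A).2
      rw [Matrix.mul_inv_rev, Matrix.transpose_transpose, Matrix.nonsing_inv_nonsing_inv _ hLd,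
        Matrix.transpose_nonsing_inv, Matrix.nonsing_inv_nonsing_inv _ (by simpa using hLd)]
      exact hL.2.2
  obtain ⟨P, hP, h⟩ := exists_rmul_eq_of_g_eq (hU hA) (A' := ((L⁻¹)ᵀ, (g A).1 * (L⁻¹)ᵀ)) hLi hg
  refine ⟨?_, hg⟩
  rw [h]
  exact (hadm P hP A hA).1

/-- With these ranks, the value `rank Q_j + j` demanded is `n - 1`, which uniqueness forces. -/
theorem nonRedundantAt_of_frameUnique (hU : U ⊆ structParams n m) (hadm : Admissible U f)
    (hq : ∀ j : Fin n, (Q j).rank = n - (j.val + 1)) {A : StructPair n m} (hA : A ∈ U)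
    (hu : ∀ A' ∈ U, g A' = g A → FrameUnique Q (f A')) : NonRedundantAt f Q (g A) := by
  obtain ⟨L, hL⟩ := exists_isCholesky_g (hU hA)
  obtain ⟨hm, hg⟩ := cholesky_mem hU hadm hA hL
  have hq' : ∀ j : Fin n, (Q j).rank + (j.val + 1) ≤ n := fun j => by
    have := hq j
    omega
  refine ⟨L, hL, fun p j _ hp => ?_⟩
  have h1 := IsPartialFrame.rank_qtilde_add_one hq' (hu _ hm hg) (p := p) (j := j)
    (fun i hi => hp i hi)
  have h2 := hq j
  omega

/-- `h0` supplies the first index, on which `NonRedundantAt` is silent. -/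
theorem NonRedundantAt.existsUnique_restricted (hU : U ⊆ structParams n m) (hN : IsNormalization N)
    (hadm : Admissible U f) (hq : ∀ j : Fin n, (Q j).rank = n - (j.val + 1))
    {A : StructPair n m} (hA : A ∈ U) (hr : NonRedundantAt f Q (g A))
    (h0 : ∀ A' ∈ U, g A' = g A → ∀ j : Fin n, j.val = 0 → n ≤ (Q j * f A').rank + 1) :
    ∃! A', A' ∈ restricted U N f Q ∧ g A' = g A := by
  obtain ⟨L, hL, hp⟩ := hr
  obtain ⟨hm, hg⟩ := cholesky_mem hU hadm hA hL
  rw [← hg, existsUnique_restricted_iff hU hN hadm hm]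
  have hq' : ∀ j : Fin n, (Q j).rank + (j.val + 1) ≤ n := fun j => by
    have := hq j
    omega
  refine ⟨exists_isFrame hq', frameUnique_of_le_rank fun p j hpf => ?_⟩
  rcases Nat.eq_zero_or_pos j.val with hj | hj
  · refine (h0 _ hm hg j hj).trans (Nat.add_le_add_right ?_ 1)
    exact Matrix.rank_submatrix_le (Qtilde Q (f _) p j) Sum.inl id
  · have h1 := hp p j hj fun i _ => hpf i
    have h2 := hq j
    rw [h1]
    omega

end Orbits

/-! ### Smoothness of the reduced-form map -/

section Generic

open Set Topology

/-- The topology on matrices that underlies the sup norm. -/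
@[reducible] def matrixTopology (a b : ℕ) : TopologicalSpace (Matrix (Fin a) (Fin b) ℝ) :=
  Matrix.normedAddCommGroup.toPseudoMetricSpace.toUniformSpace.toTopologicalSpace

attribute [local instance] matrixTopology

/-- The Borel σ-algebra on matrices. -/
@[reducible] def matrixBorel (a b : ℕ) : MeasurableSpace (Matrix (Fin a) (Fin b) ℝ) := borel _

attribute [local instance] matrixBorel

theorem borelSpace_matrix (a b : ℕ) : BorelSpace (Matrix (Fin a) (Fin b) ℝ) := ⟨rfl⟩

attribute [local instance] borelSpace_matrix

section Smooth

variable {E : Type*} [NormedAddCommGroup E] [NormedSpace ℝ E] {x : E}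

theorem contDiffAt_matrix {a b : ℕ} {F : E → Matrix (Fin a) (Fin b) ℝ}
    (h : ∀ i j, ContDiffAt ℝ 1 (fun y => F y i j) x) : ContDiffAt ℝ 1 F x :=
  contDiffAt_pi.2 fun i => contDiffAt_pi.2 fun j => h i j

theorem ContDiffAt.matrix_entry {a b : ℕ} {F : E → Matrix (Fin a) (Fin b) ℝ}
    (h : ContDiffAt ℝ 1 F x) (i : Fin a) (j : Fin b) : ContDiffAt ℝ 1 (fun y => F y i j) x :=
  contDiffAt_pi.1 (contDiffAt_pi.1 h i) j

theorem ContDiffAt.matrix_mul {a b c : ℕ} {F : E → Matrix (Fin a) (Fin b) ℝ}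
    {H : E → Matrix (Fin b) (Fin c) ℝ} (hF : ContDiffAt ℝ 1 F x) (hH : ContDiffAt ℝ 1 H x) :
    ContDiffAt ℝ 1 (fun y => F y * H y) x := by
  refine contDiffAt_matrix fun i j => ?_
  simp only [Matrix.mul_apply]
  exact ContDiffAt.sum fun l _ =>
    (ContDiffAt.matrix_entry hF i l).mul (ContDiffAt.matrix_entry hH l j)

theorem ContDiffAt.matrix_transpose {a b : ℕ} {F : E → Matrix (Fin a) (Fin b) ℝ}
    (hF : ContDiffAt ℝ 1 F x) : ContDiffAt ℝ 1 (fun y => (F y)ᵀ) x :=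
  contDiffAt_matrix fun i j => ContDiffAt.matrix_entry hF j i

theorem ContDiffAt.matrix_det {a : ℕ} {F : E → Matrix (Fin a) (Fin a) ℝ}
    (hF : ContDiffAt ℝ 1 F x) : ContDiffAt ℝ 1 (fun y => (F y).det) x := by
  simp only [Matrix.det_apply]
  exact ContDiffAt.sum fun σ _ => ContDiffAt.const_smul _
    (contDiffAt_prod fun i _ => ContDiffAt.matrix_entry hF _ _)

theorem ContDiffAt.matrix_inv {a : ℕ} {F : E → Matrix (Fin a) (Fin a) ℝ}
    (hF : ContDiffAt ℝ 1 F x) (h : IsUnit (F x).det) : ContDiffAt ℝ 1 (fun y => (F y)⁻¹) x := by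
  refine contDiffAt_matrix fun i j => ?_
  simp only [Matrix.inv_def, Ring.inverse_eq_inv', Matrix.smul_apply, smul_eq_mul,
    Matrix.adjugate_apply]
  refine ((ContDiffAt.matrix_det hF).inv h.ne_zero).mul (ContDiffAt.matrix_det ?_)
  refine contDiffAt_matrix fun l l' => ?_
  by_cases hl : l = j
  · subst hl
    simp only [Matrix.updateRow_self]
    exact contDiffAt_const
  · simp only [Matrix.updateRow_ne hl]
    exact ContDiffAt.matrix_entry hF _ _

end Smooth

variable {n m k : ℕ}

theorem contDiffAt_g {A : StructPair n m} (hA : A ∈ structParams n m) :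
    ContDiffAt ℝ 1 (g : StructPair n m → RedPair n m) A := by
  have hA : IsUnit A.1.det := hA
  refine ContDiffAt.prodMk (ContDiffAt.matrix_mul contDiffAt_snd
    (ContDiffAt.matrix_inv contDiffAt_fst hA)) (ContDiffAt.matrix_inv
      (ContDiffAt.matrix_mul contDiffAt_fst (ContDiffAt.matrix_transpose contDiffAt_fst)) ?_)
  simpa [Matrix.det_mul] using hA

theorem contDiffAt_redCoord_g {A : StructPair n m} (hA : A ∈ structParams n m) :
    ContDiffAt ℝ 1 (fun A : StructPair n m => redCoord (g A)) A := by
  refine ContDiffAt.prodMk ?_ ?_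
  · exact contDiffAt_pi.2 fun i => contDiffAt_pi.2 fun j =>
      ContDiffAt.matrix_entry (contDiffAt_g hA).fst i j
  · exact contDiffAt_pi.2 fun ij => ContDiffAt.matrix_entry (contDiffAt_g hA).snd _ _

/-- In the coordinates `M = A₀⁻¹` and `B`, the map `g` is polynomial, so its derivative is easy to
compute. -/
theorem g_inv {M : Matrix (Fin n) (Fin n) ℝ} (hM : IsUnit M.det) (B : Matrix (Fin m) (Fin n) ℝ) :
    g ((M⁻¹, B * M⁻¹) : StructPair n m) = (B, Mᵀ * M) := by
  refine Prod.ext ?_ ?_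
  · change B * M⁻¹ * M⁻¹⁻¹ = B
    rw [Matrix.mul_nonsing_inv_cancel_right _ _ (Matrix.isUnit_nonsing_inv_det _ hM)]
  · change (M⁻¹ * M⁻¹ᵀ)⁻¹ = Mᵀ * M
    rw [Matrix.mul_inv_rev, Matrix.transpose_nonsing_inv, Matrix.nonsing_inv_nonsing_inv _ hM,
      Matrix.nonsing_inv_nonsing_inv _ (by simpa using hM)]

/-- The map to the coordinates of the reduced form is a submersion. -/
theorem range_fderiv_redCoord_g {A : StructPair n m} (hA : A ∈ structParams n m) :
    (fderiv ℝ (fun A : StructPair n m => redCoord (g A)) A).range = ⊤ := by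
  have hA' : IsUnit A.1.det := hA
  rw [LinearMap.range_eq_top]
  rintro ⟨b, s⟩
  let S : Matrix (Fin n) (Fin n) ℝ := Matrix.of fun i j =>
    if h : j ≤ i then s ⟨(i, j), h⟩ else s ⟨(j, i), (not_le.1 h).le⟩
  have hS : Sᵀ = S := by
    ext i j
    simp only [S, Matrix.transpose_apply, Matrix.of_apply]
    rcases lt_trichotomy i j with h | rfl | h
    · rw [dif_pos h.le, dif_neg (not_le.2 h)]
    · rfl
    · rw [dif_neg (not_le.2 h), dif_pos h.le]
  let M := A.1⁻¹
  let B := A.2 * A.1⁻¹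
  -- `K` solves `Mᵀ K + Kᵀ M = S`, the linearization of `Mᵀ M`; the curve `c` below thus has image
  -- velocity `(b, s)`.
  let K : Matrix (Fin n) (Fin n) ℝ := (1 / 2 : ℝ) • (A.1ᵀ * S)
  have hMK : Mᵀ * K = (1 / 2 : ℝ) • S := by
    rw [Matrix.mul_smul, ← Matrix.mul_assoc, ← Matrix.transpose_mul, Matrix.mul_nonsing_inv _ hA',
      Matrix.transpose_one, Matrix.one_mul]
  have hKM : Kᵀ * M = (1 / 2 : ℝ) • S := by
    rw [← Matrix.transpose_transpose M, ← Matrix.transpose_mul, hMK, Matrix.transpose_smul, hS]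
  let c : ℝ → StructPair n m := fun t =>
    ((M + t • K)⁻¹, (B + t • Matrix.of b) * (M + t • K)⁻¹)
  have hMt : ContDiffAt ℝ 1 (fun t : ℝ => M + t • K) 0 := by fun_prop
  have hM : IsUnit M.det := Matrix.isUnit_nonsing_inv_det _ hA'
  have hM0 : IsUnit (M + (0 : ℝ) • K).det := by rwa [zero_smul, add_zero]
  have hinv := ContDiffAt.matrix_inv hMt hM0
  have hc : ContDiffAt ℝ 1 c 0 :=
    ContDiffAt.prodMk hinv (ContDiffAt.matrix_mul (by fun_prop) hinv)
  have hc0 : c 0 = A := by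
    simp only [c, zero_smul, add_zero, M, B, Matrix.nonsing_inv_nonsing_inv _ hA']
    rw [Matrix.nonsing_inv_mul_cancel_right _ _ hA']
  have hev : ∀ᶠ t : ℝ in 𝓝 0, redCoord (g (c t)) =
      ((fun i j => B i j + t * b i j : Fin m → Fin n → ℝ),
        fun ij : {ij : Fin n × Fin n // ij.2 ≤ ij.1} => (Mᵀ * M) ij.1.1 ij.1.2 + t * s ij +
          t ^ 2 * (Kᵀ * K) ij.1.1 ij.1.2) := by
    have h1 : ∀ᶠ t : ℝ in 𝓝 0, (M + t • K).det ≠ 0 :=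
      (ContDiffAt.matrix_det hMt).continuousAt.eventually_ne hM0.ne_zero
    filter_upwards [h1] with t ht
    rw [g_inv (isUnit_iff_ne_zero.2 ht)]
    have h2 : (M + t • K)ᵀ * (M + t • K) = Mᵀ * M + t • S + t ^ 2 • (Kᵀ * K) := by
      rw [Matrix.transpose_add, Matrix.transpose_smul, Matrix.add_mul, Matrix.mul_add,
        Matrix.mul_add, Matrix.smul_mul, Matrix.smul_mul, Matrix.mul_smul _ t K,
        Matrix.mul_smul _ t K, hMK, hKM]
      module
    rw [h2]
    refine Prod.ext ?_ ?_
    · ext i j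
      simp [redCoord]
    · ext ⟨⟨i, j⟩, hij⟩
      simp only [redCoord, Matrix.add_apply, Matrix.smul_apply, smul_eq_mul, S, Matrix.of_apply]
      rw [dif_pos hij]
  have hd1 : HasDerivAt (fun t => redCoord (g (c t))) (b, s) 0 := by
    refine HasDerivAt.congr_of_eventuallyEq ?_ hev
    refine HasDerivAt.prodMk (hasDerivAt_pi.2 fun i => hasDerivAt_pi.2 fun j => ?_)
      (hasDerivAt_pi.2 fun ij => ?_)
    · simpa using ((hasDerivAt_id (0 : ℝ)).mul_const (b i j)).const_add (B i j)
    · have h1 := ((hasDerivAt_id (0 : ℝ)).mul_const (s ij)).const_add ((Mᵀ * M) ij.1.1 ij.1.2)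
      have h2 := ((hasDerivAt_id (0 : ℝ)).pow 2).mul_const ((Kᵀ * K) ij.1.1 ij.1.2)
      simpa using! h1.add h2
  have hd2 : HasDerivAt (fun t => redCoord (g (c t)))
      (fderiv ℝ (fun A : StructPair n m => redCoord (g A)) A (deriv c 0)) 0 := by
    have h1 := (contDiffAt_redCoord_g hA).differentiableAt one_ne_zero
    rw [← hc0] at h1
    have h2 := h1.hasFDerivAt.comp_hasDerivAt (0 : ℝ)
      (hc.differentiableAt one_ne_zero).hasDerivAt
    rwa [hc0] at h2
  exact ⟨deriv c 0, hd2.unique hd1⟩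

theorem redCoord_injOn_redParams : InjOn (redCoord (n := n) (m := m)) (redParams n m) := by
  rintro ⟨B, S⟩ hS ⟨B', S'⟩ hS' h
  have h1 : B = B' := congrArg Prod.fst h
  have h2 := congrArg Prod.snd h
  have hs : ∀ i j, S i j = S j i := fun i j => (Matrix.IsHermitian.apply hS.isHermitian j i)
  have hs' : ∀ i j, S' i j = S' j i := fun i j => (Matrix.IsHermitian.apply hS'.isHermitian j i)
  have h3 : ∀ i j, j ≤ i → S i j = S' i j := fun i j hij => congrFun h2 ⟨(i, j), hij⟩
  refine Prod.ext h1 ?_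
  ext i j
  rcases le_total j i with hij | hij
  · exact h3 i j hij
  · exact (hs i j).trans ((h3 j i hij).trans (hs' j i))

theorem isAddHaarMeasure_volume_redCoord (ι : Type*) [Fintype ι] :
    (volume : Measure ((Fin m → Fin n → ℝ) × (ι → ℝ))).IsAddHaarMeasure := by
  have : (volume : Measure (Fin m → Fin n → ℝ)).IsAddHaarMeasure :=
    Measure.pi.isAddHaarMeasure fun _ => volume
  exact Measure.prod.instIsAddHaarMeasure volume volume

/-- Almost every attainable reduced form has a property if and only if the reduced form of almost
every structural parameter does. -/
theorem almostEvery_image_g_iff (μ : Measure (StructPair n m)) [μ.IsAddHaarMeasure]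
    {U : Set (StructPair n m)} (hUo : IsOpen U) (hU : U ⊆ structParams n m)
    (p : RedPair n m → Prop) :
    AlmostEvery (g '' U) p ↔ μ {A | A ∈ U ∧ ¬ p (g A)} = 0 := by
  have := isAddHaarMeasure_volume_redCoord (n := n) (m := m) {ij : Fin n × Fin n // ij.2 ≤ ij.1}
  constructor
  · intro h
    refine measure_mono_null ?_ (measure_inter_preimage_eq_zero μ volume
      (fun A hA => contDiffAt_redCoord_g (hU hA)) (fun A hA => range_fderiv_redCoord_g (hU hA)) h)
    rintro A ⟨hA, hp⟩
    exact ⟨hA, g A, ⟨mem_image_of_mem g hA, posDef_g (hU hA), hp⟩, rfl⟩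
  · intro h
    refine measure_mono_null ?_ (measure_inter_image_eq_zero μ volume hUo
      (T := redCoord '' {r | r ∈ g '' U ∧ r ∈ redParams n m ∧ ¬ p r})
      (fun A hA => contDiffAt_redCoord_g (hU hA)) (fun A hA => range_fderiv_redCoord_g (hU hA))
      (measure_mono_null ?_ h))
    · rintro _ ⟨r, hr, rfl⟩
      obtain ⟨A, hA, rfl⟩ := hr.1
      exact ⟨⟨_, hr, rfl⟩, A, hA, rfl⟩
    · rintro A ⟨hA, r, ⟨-, hr, hpr⟩, hrA⟩
      refine ⟨hA, ?_⟩
      rwa [← redCoord_injOn_redParams hr (posDef_g (hU hA)) hrA]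

/-! ### Generic ranks and existence of frames -/

/-- A matrix of rank at least `s` has an invertible `s × s` compression. -/
theorem exists_mul_mul_eq_one {k s : ℕ} {Q : Matrix (Fin k) (Fin k) ℝ} (hs : s ≤ Q.rank) :
    ∃ (G : Matrix (Fin s) (Fin k) ℝ) (H : Matrix (Fin k) (Fin s) ℝ), G * Q * H = 1 := by
  obtain ⟨b, hb⟩ := exists_linearIndependent_of_le_finrank (R := ℝ)
    (M := LinearMap.range Q.mulVecLin) hs
  have hb' : ∀ i, ∃ h, Q *ᵥ h = (b i).1 := fun i => (b i).2
  choose h hh using hb'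
  have hli : LinearIndependent ℝ fun i => (b i).1 :=
    hb.map' (LinearMap.range Q.mulVecLin).subtype (Submodule.ker_subtype _)
  let H : Matrix (Fin k) (Fin s) ℝ := (Matrix.of h)ᵀ
  have hQH : (Q * H).col = fun i => (b i).1 := by
    ext i l
    rw [← hh i]
    rfl
  rw [← hQH, ← Matrix.mulVec_injective_iff] at hli
  obtain ⟨G, hG⟩ := (Q * H).mulVecLin.exists_leftInverse_of_injective (LinearMap.ker_eq_bot.2 hli)
  refine ⟨LinearMap.toMatrix' G, H, ?_⟩
  rw [Matrix.mul_assoc, ← LinearMap.toMatrix'_toLin' (Q * H), ← LinearMap.toMatrix'_comp,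
    Matrix.toLin'_apply', hG, LinearMap.toMatrix'_id]

/-- If `G Q H = 1`, moving `X` by `t H Jᵀ` adds `t` times the identity to `G Q X J`. Its determinant
is then a monic characteristic polynomial in `t`, with finitely many zeros on each such line. -/
theorem ae_le_rank_mul_mul {s : ℕ} (μ : Measure (Matrix (Fin k) (Fin n) ℝ)) [μ.IsAddHaarMeasure]
    {Q : Matrix (Fin k) (Fin k) ℝ} (hs : s ≤ Q.rank) {J : Matrix (Fin n) (Fin s) ℝ}
    (hJ : Jᵀ * J = 1) : ∀ᵐ X ∂μ, s ≤ (Q * X * J).rank := by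
  obtain ⟨G, H, hGH⟩ := exists_mul_mul_eq_one hs
  have hc : Continuous fun X : Matrix (Fin k) (Fin n) ℝ => (G * (Q * X * J)).det :=
    continuous_iff_continuousAt.2 fun X => (ContDiffAt.matrix_det (ContDiffAt.matrix_mul
      contDiffAt_const (ContDiffAt.matrix_mul (ContDiffAt.matrix_mul contDiffAt_const contDiffAt_id)
        contDiffAt_const))).continuousAt
  have hae : ∀ᵐ X ∂μ, X ∈ {X | (G * (Q * X * J)).det ≠ 0} := by
    refine ae_mem_of_ae_add_linearMap_mem
      (LinearMap.toSpanSingleton ℝ (Matrix (Fin k) (Fin n) ℝ) (H * Jᵀ)) volume μ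
      ((isOpen_ne_fun hc continuous_const).measurableSet) fun X => ?_
    let P := (-(G * (Q * X * J))).charpoly
    have hP : P ≠ 0 := (Matrix.charpoly_monic _).ne_zero
    have hfin : {t : ℝ | P.IsRoot t}.Finite := Polynomial.finite_setOfPred_isRoot hP
    filter_upwards [measure_eq_zero_iff_ae_notMem.1 (hfin.measure_zero volume)] with t ht
    intro h0
    refine ht ?_
    change P.eval t = 0
    rw [Matrix.eval_charpoly, ← h0, LinearMap.toSpanSingleton_apply]
    congr 1
    rw [sub_neg_eq_add, Matrix.mul_add, Matrix.add_mul, Matrix.mul_add, add_comm]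
    congr 1
    rw [Matrix.mul_smul, Matrix.smul_mul, Matrix.mul_smul, Matrix.mul_assoc, Matrix.mul_assoc H, hJ,
      Matrix.mul_one, ← Matrix.mul_assoc, hGH, Matrix.scalar_apply, Matrix.smul_one_eq_diagonal]
  filter_upwards [hae] with X hX
  have h1 := Matrix.rank_of_isUnit _ ((Matrix.isUnit_iff_isUnit_det _).2 (isUnit_iff_ne_zero.2 hX))
  rw [Fintype.card_fin] at h1
  exact h1.symm.le.trans (Matrix.rank_mul_le_right _ _)

/-- The inclusion of the first `s` coordinates. -/
def inclusionMatrix {s : ℕ} (h : s ≤ n) : Matrix (Fin n) (Fin s) ℝ :=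
  (1 : Matrix (Fin n) (Fin n) ℝ).submatrix id (Fin.castLE h)

theorem inclusionMatrix_transpose_mul {s : ℕ} (h : s ≤ n) :
    (inclusionMatrix h)ᵀ * inclusionMatrix h = 1 := by
  rw [inclusionMatrix, Matrix.transpose_submatrix, Matrix.transpose_one,
    ← Matrix.submatrix_mul _ _ _ _ _ Function.bijective_id, Matrix.mul_one,
    Matrix.submatrix_one _ (Fin.castLE_injective h)]

/-- If every matrix admits a frame, then there are few restrictions. -/
theorem rank_add_le_of_forall_exists_isFrame {Q : Fin n → Matrix (Fin k) (Fin k) ℝ}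
    (hQ : ∀ i j : Fin n, i ≤ j → (Q j).rank ≤ (Q i).rank)
    (hex : ∀ X : Matrix (Fin k) (Fin n) ℝ, ∃ p, IsFrame Q X p) (j : Fin n) :
    (Q j).rank + (j.val + 1) ≤ n := by
  by_contra hlt
  -- The negated bound says exactly that `s ≤ rank Q_j`; the ranks of the earlier `Q_i` are no
  -- smaller.
  let s := n - j.val
  have hs : s ≤ n := Nat.sub_le _ _
  let J := inclusionMatrix hs
  have hJ : Jᵀ * J = 1 := inclusionMatrix_transpose_mul hs
  let μ : Measure (Matrix (Fin k) (Fin n) ℝ) := Measure.addHaar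
  have hae : ∀ᵐ X ∂μ, ∀ i : {i : Fin n // i ≤ j}, s ≤ (Q i * X * J).rank := by
    rw [ae_all_iff]
    intro i
    refine ae_le_rank_mul_mul μ ?_ hJ
    have := hQ i j i.2
    omega
  obtain ⟨X, hX⟩ := hae.exists
  -- Each `Q i * X * J` with `i ≤ j` is injective, so `Jᵀ` kills the first `j + 1` frame vectors,
  -- although its kernel has dimension only `j`.
  obtain ⟨p, hp⟩ := hex (X * J * Jᵀ)
  obtain ⟨hp1, hp2⟩ := isFrame_iff.1 hp
  have hker : ∀ i ≤ j, Jᵀ *ᵥ p i = 0 := by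
    intro i hi
    have h1 := rank_add_finrank_ker (Q i * X * J)
    have h2 := hX ⟨i, hi⟩
    have h3 : LinearMap.ker (Q i * X * J).mulVecLin = ⊥ :=
      Submodule.finrank_eq_zero.1 (by dsimp only at h2; omega)
    have h4 : Jᵀ *ᵥ p i ∈ LinearMap.ker (Q i * X * J).mulVecLin := by
      rw [LinearMap.mem_ker, Matrix.mulVecLin_apply, Matrix.mulVec_mulVec, ← hp1 i]
      simp only [Matrix.mul_assoc]
    rwa [h3, Submodule.mem_bot] at h4
  let M : Matrix (Fin (j.val + 1)) (Fin n) ℝ :=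
    Matrix.of fun i => p (Fin.castLE (Nat.succ_le_of_lt j.2) i)
  have hMM : M * Mᵀ = 1 := by
    ext a b
    have := congrFun (congrFun hp2 (Fin.castLE (Nat.succ_le_of_lt j.2) a))
      (Fin.castLE (Nat.succ_le_of_lt j.2) b)
    simp only [Matrix.mul_apply, Matrix.transpose_apply, Matrix.of_apply, M, Matrix.one_apply,
      Fin.castLE_inj] at this ⊢
    exact this
  have hMJ : M * J = 0 := by
    ext a b
    have := congrFun (hker (Fin.castLE (Nat.succ_le_of_lt j.2) a)
      (Nat.lt_succ_iff.1 a.2)) b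
    rw [Matrix.mulVec, dotProduct_comm] at this
    exact this
  have h1 := Matrix.rank_add_rank_le_card_of_mul_eq_zero hMJ
  have h2 := Matrix.rank_mul_le_left M Mᵀ
  have h3 := Matrix.rank_mul_le_right Jᵀ J
  rw [hMM, Matrix.rank_one, Fintype.card_fin] at h2
  rw [hJ, Matrix.rank_one, Fintype.card_fin] at h3
  rw [Fintype.card_fin] at h1
  have := j.2
  omega

/-- Frames are points of the compact orthogonal group, and projection along a compact factor is a
closed map. -/
theorem isClosed_setOf_exists_isFrame (Q : Fin n → Matrix (Fin k) (Fin k) ℝ) :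
    IsClosed {X : Matrix (Fin k) (Fin n) ℝ | ∃ p, IsFrame Q X p} := by
  let O : Set (Matrix (Fin n) (Fin n) ℝ) := {P | P * Pᵀ = 1}
  have hO : IsCompact O := by
    refine Metric.isCompact_of_isClosed_isBounded (isClosed_eq ?_ continuous_const)
      ((Metric.isBounded_closedBall (x := 0) (r := 1)).subset fun P hP => ?_)
    · exact continuous_iff_continuousAt.2 fun P => (ContDiffAt.matrix_mul contDiffAt_id
        (ContDiffAt.matrix_transpose contDiffAt_id)).continuousAt
    rw [mem_closedBall_zero_iff, Matrix.norm_le_iff zero_le_one]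
    intro i j
    have h1 := congrFun (congrFun (show P * Pᵀ = 1 from hP) i) i
    rw [Matrix.mul_apply, Matrix.one_apply_eq] at h1
    have h2 : P i j * P i j ≤ 1 := by
      rw [← h1]
      exact Finset.single_le_sum (f := fun l => P i l * Pᵀ l i)
        (fun l _ => mul_self_nonneg (P i l)) (Finset.mem_univ j)
    rw [Real.norm_eq_abs]
    exact abs_le_one_iff_mul_self_le_one.2 h2
  have : CompactSpace O := isCompact_iff_compactSpace.1 hO
  let C : Set (O × Matrix (Fin k) (Fin n) ℝ) := {z | ∀ i, (Q i * z.2) *ᵥ (z.1.1 i) = 0}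
  have hC : IsClosed C := by
    simp only [C, ofPred_forall]
    refine isClosed_iInter fun i => isClosed_eq ?_ continuous_const
    have h1 : Continuous fun z : Matrix (Fin n) (Fin n) ℝ × Matrix (Fin k) (Fin n) ℝ =>
        (Q i * z.2) *ᵥ z.1 i := by
      refine continuous_pi fun a => ?_
      simp only [Matrix.mulVec, dotProduct]
      refine continuous_finsetSum _ fun b _ => continuous_iff_continuousAt.2 fun z => ?_
      exact ((ContDiffAt.matrix_entry (ContDiffAt.matrix_mul contDiffAt_const contDiffAt_snd) a
        b).mul (ContDiffAt.matrix_entry contDiffAt_fst i b)).continuousAt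
    exact h1.comp (by fun_prop : Continuous fun z : O × Matrix (Fin k) (Fin n) ℝ => (z.1.1, z.2))
  convert isClosedMap_snd_of_compactSpace C hC
  ext X
  constructor
  · rintro ⟨p, hp⟩
    obtain ⟨h1, h2⟩ := isFrame_iff.1 hp
    exact ⟨(⟨Matrix.of p, h2⟩, X), h1, rfl⟩
  · rintro ⟨⟨P, X⟩, hP, rfl⟩
    exact ⟨fun i j => P.1 i j, isFrame_iff.2 ⟨hP, P.2⟩⟩

end Generic

/-! ### The two implications -/

section Main

open Set

attribute [local instance] matrixTopology matrixBorel borelSpace_matrix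

variable {n m k : ℕ} {U N : Set (StructPair n m)}
  {f : StructPair n m → Matrix (Fin k) (Fin n) ℝ} {Q : Fin n → Matrix (Fin k) (Fin k) ℝ}

/-- The points whose reduced form is generated by exactly one restricted structural parameter. -/
def identifiedPoints (U N : Set (StructPair n m)) (f : StructPair n m → Matrix (Fin k) (Fin n) ℝ)
    (Q : Fin n → Matrix (Fin k) (Fin k) ℝ) : Set (StructPair n m) :=
  {A | ∃! A' : StructPair n m, A' ∈ restricted U N f Q ∧ g A' = g A}

/-- The preimage of `O` in `U` is open and, by density, nonempty; having positive measure, it is not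
contained in the exceptional null set. -/
theorem exists_mem_identifiedPoints (μ : Measure (StructPair n m)) [μ.IsAddHaarMeasure]
    (hUo : IsOpen U) (hf : ContinuousOn f U) (hd : Dense (f '' U))
    (hμ : μ {A | A ∈ U ∧ A ∉ identifiedPoints U N f Q} = 0)
    {O : Set (Matrix (Fin k) (Fin n) ℝ)} (hO : IsOpen O) (hne : O.Nonempty) :
    ∃ A ∈ U, f A ∈ O ∧ A ∈ identifiedPoints U N f Q := by
  obtain ⟨_, hXO, A, hA, rfl⟩ := hd.inter_open_nonempty O hO hne
  have hpos := (hf.isOpen_inter_preimage hUo hO).measure_pos μ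
    (show (U ∩ f ⁻¹' O).Nonempty from ⟨A, hA, hXO⟩)
  by_contra! h
  refine hpos.ne' (measure_mono_null ?_ hμ)
  exact fun B hB => ⟨hB.1, h B hB.1 hB.2⟩

theorem rank_eq_of_ae_identified (μ : Measure (StructPair n m)) [μ.IsAddHaarMeasure]
    (hU : U ⊆ structParams n m) (hN : IsNormalization N) (hadm : Admissible U f)
    (hQ : ∀ i j : Fin n, i ≤ j → (Q j).rank ≤ (Q i).rank)
    (hUo : IsOpen U) (hf : ContinuousOn f U) (hd : Dense (f '' U))
    (hμ : μ {A | A ∈ U ∧ A ∉ identifiedPoints U N f Q} = 0) (j : Fin n) :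
    (Q j).rank = n - (j.val + 1) := by
  have hdense : Dense {X : Matrix (Fin k) (Fin n) ℝ | ∃ p, IsFrame Q X p} := by
    rw [dense_iff_inter_open]
    intro O hO hne
    obtain ⟨A, hA, hAO, hid⟩ := exists_mem_identifiedPoints μ hUo hf hd hμ hO hne
    exact ⟨f A, hAO, ((existsUnique_restricted_iff hU hN hadm hA).1 hid).1⟩
  have hall : ∀ X : Matrix (Fin k) (Fin n) ℝ, ∃ p, IsFrame Q X p := by
    intro X
    have h := hdense X
    rwa [(isClosed_setOf_exists_isFrame Q).closure_eq] at h
  obtain ⟨A, hA, -, hid⟩ := exists_mem_identifiedPoints μ hUo hf hd hμ isOpen_univ ⟨0, mem_univ _⟩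
  exact rank_eq_of_frameUnique (rank_add_le_of_forall_exists_isFrame hQ hall)
    ((existsUnique_restricted_iff hU hN hadm hA).1 hid).2 j

theorem ae_nonRedundantAt_of_ae_identified (μ : Measure (StructPair n m))
    (hU : U ⊆ structParams n m) (hN : IsNormalization N) (hadm : Admissible U f)
    (hq : ∀ j : Fin n, (Q j).rank = n - (j.val + 1))
    (hμ : μ {A | A ∈ U ∧ A ∉ identifiedPoints U N f Q} = 0) :
    μ {A | A ∈ U ∧ ¬ NonRedundantAt f Q (g A)} = 0 := by
  refine measure_mono_null ?_ hμ
  rintro A ⟨hA, hr⟩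
  refine ⟨hA, fun hid => hr (nonRedundantAt_of_frameUnique hU hadm hq hA fun A' hA' hg => ?_)⟩
  refine ((existsUnique_restricted_iff hU hN hadm hA').1 ?_).2
  rw [hg]
  exact hid

/-- Only the first restriction needs an argument: the matrices `X` for which `Q_1 X` has rank below
`n - 1` are null, and so is their preimage under the submersion `f`. -/
theorem ae_identified_of_ae_nonRedundantAt (μ : Measure (StructPair n m)) [μ.IsAddHaarMeasure]
    (hU : U ⊆ structParams n m) (hN : IsNormalization N) (hadm : Admissible U f)
    (hf : ∀ A ∈ U, ContDiffAt ℝ 1 f A) (hr : ∀ A ∈ U, (fderiv ℝ f A).range = ⊤)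
    (hq : ∀ j : Fin n, (Q j).rank = n - (j.val + 1))
    (hμ : μ {A | A ∈ U ∧ ¬ NonRedundantAt f Q (g A)} = 0) :
    μ {A | A ∈ U ∧ A ∉ identifiedPoints U N f Q} = 0 := by
  let ν : Measure (Matrix (Fin k) (Fin n) ℝ) := Measure.addHaar
  have hae : ∀ᵐ X ∂ν, ∀ j : {j : Fin n // j.val = 0}, n ≤ (Q j * X).rank + 1 := by
    rw [ae_all_iff]
    rintro ⟨j, hj⟩
    have h1 : n - 1 ≤ (Q j).rank := by rw [hq j, hj]
    filter_upwards [ae_le_rank_mul_mul ν h1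
      (inclusionMatrix_transpose_mul (Nat.sub_le n 1))] with X hX
    have h2 := hX.trans (Matrix.rank_mul_le_left _ _)
    omega
  refine measure_mono_null ?_ (measure_union_null hμ
    (measure_inter_preimage_eq_zero μ ν hf hr (ae_iff.1 hae)))
  rintro A ⟨hA, hid⟩
  by_contra hnot
  simp only [mem_union, mem_inter_iff, mem_preimage, not_or, not_and] at hnot
  refine hid (NonRedundantAt.existsUnique_restricted hU hN hadm hq hA
    (not_not.1 fun h => hnot.1 ⟨hA, h⟩) fun A' hA' hg j hj => ?_)
  have h1 := not_not.1 (hnot.2 hA) ⟨j, hj⟩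
  -- The rank bound at `A` passes to the whole orbit, since `f A = f A' * P`.
  obtain ⟨P, hP, rfl⟩ := exists_rmul_eq_of_g_eq (hU hA') (hU hA) hg.symm
  rw [(hadm P hP A' hA').2, ← Matrix.mul_assoc] at h1
  exact h1.trans (Nat.add_le_add_right (Matrix.rank_mul_le_left _ _) 1)

theorem exactlyIdentified_iff (hU : U ⊆ structParams n m) (hN : IsNormalization N)
    (hQ : ∀ i j : Fin n, i ≤ j → (Q j).rank ≤ (Q i).rank)
    (hadm : Admissible U f) (hreg : StronglyRegular U f) :
    ExactlyIdentified U N f Q ↔ (∀ j : Fin n, (Q j).rank = n - (j.val + 1)) ∧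
      AlmostEvery (g '' U) (NonRedundantAt f Q) := by
  have hUo : IsOpen U := hreg.1.1
  have hd : Dense (f '' U) := hreg.2
  have hf : ∀ A ∈ U, ContDiffAt ℝ 1 f A := fun A hA => hreg.1.2.1.contDiffAt (hUo.mem_nhds hA)
  have hr : ∀ A ∈ U, (fderiv ℝ f A).range = ⊤ := by
    intro A hA
    refine Submodule.eq_top_of_finrank_eq ((hreg.1.2.2 A hA).trans ?_)
    rw [Module.finrank_matrix, Fintype.card_fin, Fintype.card_fin, Module.finrank_self, mul_one]
  let μ : Measure (StructPair n m) := Measure.addHaar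
  rw [ExactlyIdentified, almostEvery_image_g_iff μ hUo hU, almostEvery_image_g_iff μ hUo hU]
  constructor
  · intro h
    have hq := rank_eq_of_ae_identified μ hU hN hadm hQ hUo
      (fun A hA => (hf A hA).continuousAt.continuousWithinAt) hd h
    exact ⟨hq, ae_nonRedundantAt_of_ae_identified μ hU hN hadm hq h⟩
  · rintro ⟨hq, h⟩
    exact ae_identified_of_ae_nonRedundantAt μ hU hN hadm hf hr hq h

end Main

end SVAR

end

theorem theorem1 (n m k : ℕ)
    (U N : Set (SVAR.StructPair n m)) (hU : U ⊆ SVAR.structParams n m)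
    (hN : SVAR.IsNormalization N)
    (f : SVAR.StructPair n m → Matrix (Fin k) (Fin n) ℝ)
    (Q : Fin n → Matrix (Fin k) (Fin k) ℝ)
    (hQ : ∀ i j : Fin n, i ≤ j → (Q j).rank ≤ (Q i).rank)
    (hadm : SVAR.Admissible U f) (hreg : SVAR.StronglyRegular U f) :
    SVAR.ExactlyIdentified U N f Q ↔
      (∀ j : Fin n, (Q j).rank = n - (j.val + 1)) ∧
        SVAR.AlmostEvery (SVAR.g '' U) (SVAR.NonRedundantAt f Q) := by
  exact SVAR.exactlyIdentified_iff hU hN hQ hadm hreg
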